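/- Let $(X,\rho)$ be a non-empty compact metric space and $D$ a finite set of maps $d\colon X^{\mathrm{ar}(d)}\to X$ of positive finite arity, each contracting with respect to the maximum metric on $X^{\mathrm{ar}(d)}$, with $X=\bigcup_{d\in D}\mathrm{range}(d)$ (a digit space). Let $Q$ be a countable dense set of coded "basic elements" of $X$; all procedures below work on codes of basic elements, rationals and digits. Assume that $(X,D,Q)$ is a computable digit space: the sets $\{(u,v,r)\in Q^2\times\mathbb{Q} : \rho(u,v)<r\}$ and $\{(u,v,r)\in Q^2\times\mathbb{Q} : \rho(u,v)>r\}$ are effectively enumerable, and every $d\in D$ is computable, i.e. has a computable modulus of uniform continuity $\zeta\colon\mathbb{Q}_+\to\mathbb{Q}_+$, and from $\vec u\in Q^{\mathrm{ar}(d)}$ and $n\in\mathbb{N}$ one can compute $v\in Q$ with $\rho(d(\vec u),v)<2^{-n}$. Assume moreover that $(X,D,Q)$ is - well-covering: every $x\in X$ lies in $\mathrm{int}(\mathrm{range}(d))$ for some $d\in D$; - decidable: for $u\in Q$, $\theta\in\mathbb{Q}_+$, $d\in D$ it can be decided whether the open ball $B_\rho(u,\theta)$ is contained in $\mathrm{range}(d)$;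 - with approximable choice: for every $d\in D$ there is an effective procedure $(\theta,u)\mapsto v^\theta_u\in Q^{\mathrm{ar}(d)}$, defined for $\theta\in\mathbb{Q}_+$ and $u\in\mathrm{int}(\mathrm{range}(d))\cap Q$, such that (1) $\rho(v^\theta_u,v^{\tilde\theta}_u)<\max\{\theta,\tilde\theta\}$ for all $u,\theta,\tilde\theta$; (2) from $\theta$ one can compute $\theta'\in\mathbb{Q}_+$ such that, for all $u,u'$, $\rho(u,u')<\theta'$ implies $\rho(v^\theta_u,v^\theta_{u'})<\theta$; (3) for all $\theta,u$ there is $\vec y\in X^{\mathrm{ar}(d)}$ with $d(\vec y)=u$ and $\rho(\vec y,v^\theta_u)<\theta$. Let $\mathcal{T}^\omega_D$ be the set of infinite $D$-trees, that is, trees whose nodes are labelled by elements of $D$ and in which a node labelled $d$ has exactly $\mathrm{ar}(d)$ ordered children. Let $T^{(n)}$ be the initial segment of $T$ of height $n$. A finite tree $S$ defines a map $f_S$, where $f_S=d$ if $S$ is a single node labelled $d$, and $f_S=d\circ(f_{S_1}\times\dots\times f_{S_{\mathrm{ar}(d)}})$ if $S$ has root label $d$ and immediate subtrees $S_1,\dots,S_{\mathrm{ar}(d)}$.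 Let $[\![T]\!]$ be the unique element of $\bigcap_n\mathrm{range}(f_{T^{(n)}})$. The Cauchy representation is the partial map $\rho_C$ from $Q^\omega$ to $X$ with $\rho_C(w)=x$ iff $\rho(x,w_n)<2^{-n}$ for all $n\in\mathbb{N}$. The tree representation maps the stream $(T^{(n)})_{n\in\mathbb{N}}$ to $[\![T]\!]$. A (partial) operator is called computable if it is computed, in the sense of Type-Two Theory of Effectivity, on its domain, where trees $T$ are given by the streams $(T^{(n)})_{n\in\mathbb{N}}$ and elements of $Q^\omega$ by the sequences of (codes of) their terms. Then there are a computable operator $F\colon\mathcal{T}^\omega_D\to Q^\omega$ and a computable partial operator $G$ from $Q^\omega$ to $\mathcal{T}^\omega_D$ with $\mathrm{dom}(G)=\mathrm{dom}(\rho_C)$ such that for all $T\in\mathcal{T}^\omega_D$ and $w\in\mathrm{dom}(G)$, \[ \rho_C(F(T))=[\![T]\!]\quad\text{and}\quad[\![G(w)]\!]=\rho_C(w). \] Hence the tree representation and the Cauchy representation of $X$ are computably equivalent, i.e. names of either kind can be computably translated into names of the other kind of the same point. -/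

import Mathlib

universe u v

/-- A pair `(a, b)` of natural numbers is a code of the positive rational number `(a + 1) / (b + 1)`;
every positive rational has such a code. -/
def posRat (c : ℕ × ℕ) : ℚ := ((c.1 : ℚ) + 1) / ((c.2 : ℚ) + 1)

/-- A triple `(a, b, c)` of natural numbers is a code of the rational number `(a - b) / (c + 1)`;
every rational has such a code. -/
def ratVal (c : ℕ × ℕ × ℕ) : ℚ := ((c.1 : ℚ) - (c.2.1 : ℚ)) / ((c.2.2 : ℚ) + 1)

/-! ### Trees labelled by digits

The digits are `Fin m`, and `ar d` is the outdegree (arity) of a node labelled `d`.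
The children of a node labelled `d` are numbered `0, …, ar d - 1`. -/

/-- Finite `D`-trees: a single node, or `[d; T_1, …, T_{ar d}]`. -/
inductive FinTree {m : ℕ} (ar : Fin m → ℕ) : Type
  | leaf (d : Fin m) : FinTree ar
  | node (d : Fin m) (ts : Fin (ar d) → FinTree ar) : FinTree ar

namespace FinTree

variable {m : ℕ} {ar : Fin m → ℕ}

/-- The argument places of the map `f_S` defined by a finite tree `S`; their number is `ar(S)`,
which is `ar(d)` for a single node `d` and `∑ ar(T_i)` for `[d; T_1, …, T_{ar d}]`. -/
def Slot : FinTree ar → Type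
  | leaf d => Fin (ar d)
  | node d ts => Σ i : Fin (ar d), (ts i).Slot

/-- A finite tree as a finite object: the list, in depth-first order, of all pairs of a node
(a word over `ℕ`) and its label. -/
def graph : FinTree ar → List (List ℕ × Fin m)
  | leaf d => [([], d)]
  | node d ts =>
      ([], d) :: (List.ofFn fun i : Fin (ar d) =>
        (ts i).graph.map fun p => ((i : ℕ) :: p.1, p.2)).flatten

end FinTree

/-- Infinite `D`-trees: a non-empty tree `S` of words together with a labelling `L : S → D`, such
that a node `s` has exactly the children `s ⋆ i` with `i < ar (L s)`. The pair `(S, L)` is given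
by the partial map `label`, whose domain is `S`. -/
@[ext] structure InfTree {m : ℕ} (ar : Fin m → ℕ) : Type where
  label : List ℕ → Option (Fin m)
  root_mem : (label []).isSome
  mem_snoc : ∀ (s : List ℕ) (i : ℕ),
    (label (s ++ [i])).isSome ↔ ∃ d, label s = some d ∧ i < ar d

namespace InfTree

variable {m : ℕ} {ar : Fin m → ℕ}

/-- The label of the root. -/
def root (T : InfTree ar) : Fin m := (T.label []).get T.root_mem

theorem label_nil (T : InfTree ar) : T.label [] = some T.root := by
  simp [root]

/-- The `i`-th immediate subtree. -/
def subtree (T : InfTree ar) (i : Fin (ar T.root)) : InfTree ar where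
  label s := T.label ((i : ℕ) :: s)
  root_mem := by
    have h := (T.mem_snoc [] (i : ℕ)).2 ⟨T.root, T.label_nil, i.2⟩
    simpa using h
  mem_snoc s j := by
    have h := T.mem_snoc ((i : ℕ) :: s) j
    simpa using h

/-- The initial segment `T^(n)` of height `n`. -/
def init : ℕ → (T : InfTree ar) → FinTree ar
  | 0, T => .leaf T.root
  | n + 1, T => .node T.root fun i => init n (T.subtree i)

/-- The stream `T^(0) : T^(1) : ⋯` of finite trees by which an infinite tree is given to, or
returned by, a computation. -/
def stream (T : InfTree ar) (n : ℕ) : List (List ℕ × Fin m) := (T.init n).graph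

end InfTree

/-! ### Digit spaces -/

/-- A finite family of maps `d : X^(ar d) → X` of positive finite arity. -/
structure DigitSystem (X : Type u) (m : ℕ) where
  ar : Fin m → ℕ
  ar_pos : ∀ d, 0 < ar d
  map : ∀ d, (Fin (ar d) → X) → X

namespace DigitSystem

variable {X : Type u} {m : ℕ}

/-- The map `f_S : X^(ar S) → X` defined by a finite tree `S`. -/
def treeMap (D : DigitSystem X m) : (S : FinTree D.ar) → (S.Slot → X) → X
  | .leaf d, x => D.map d x
  | .node d ts, x => D.map d fun i => treeMap D (ts i) fun s => x ⟨i, s⟩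

/-- A digit space: a non-empty compact metric space covered by the ranges of finitely many
contracting maps, where powers of `X` carry the maximum metric. -/
structure IsDigitSpace [MetricSpace X] (D : DigitSystem X m) : Prop where
  nonempty : Nonempty X
  compact : CompactSpace X
  covering : ∀ x : X, ∃ d, x ∈ Set.range (D.map d)
  contracting : ∀ d, ∃ q : NNReal, q < 1 ∧ LipschitzWith q (D.map d)

/-- Every point lies in the interior of the range of some digit. -/
def WellCovering [MetricSpace X] (D : DigitSystem X m) : Prop :=
  ∀ x : X, ∃ d, x ∈ interior (Set.range (D.map d))

section Value

variable {D : DigitSystem X m}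

theorem range_treeMap_node (d : Fin m) (ts : Fin (D.ar d) → FinTree D.ar) :
    Set.range (D.treeMap (.node d ts)) =
      D.map d '' Set.univ.pi fun i => Set.range (D.treeMap (ts i)) := by
  ext y
  constructor
  · rintro ⟨x, rfl⟩
    exact ⟨fun i => D.treeMap (ts i) fun s => x ⟨i, s⟩, fun i _ => ⟨_, rfl⟩, rfl⟩
  · rintro ⟨z, hz, rfl⟩
    choose x hx using fun i => hz i (Set.mem_univ i)
    exact ⟨fun p => x p.1 p.2, congrArg (D.map d) (funext hx)⟩

theorem range_treeMap_init_succ (n : ℕ) (T : InfTree D.ar) :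
    Set.range (D.treeMap (T.init (n + 1))) ⊆ Set.range (D.treeMap (T.init n)) := by
  induction n generalizing T with
  | zero =>
    simp only [InfTree.init]
    rw [range_treeMap_node]
    rintro _ ⟨z, _, rfl⟩
    exact ⟨z, rfl⟩
  | succ n ih =>
    rw [InfTree.init, InfTree.init, range_treeMap_node, range_treeMap_node]
    exact Set.image_mono (Set.pi_mono fun i _ => ih (T.subtree i))

variable [MetricSpace X]

theorem IsDigitSpace.exists_factor (h : D.IsDigitSpace) :
    ∃ q : NNReal, q < 1 ∧ ∀ d, LipschitzWith q (D.map d) := by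
  choose q hq hL using h.contracting
  refine ⟨Finset.univ.sup q, ?_, fun d => (hL d).weaken (Finset.le_sup (Finset.mem_univ d))⟩
  exact (Finset.sup_lt_iff (by simp)).2 fun d _ => hq d

theorem IsDigitSpace.isCompact_range_treeMap (h : D.IsDigitSpace) (S : FinTree D.ar) :
    IsCompact (Set.range (D.treeMap S)) := by
  have := h.compact
  induction S with
  | leaf d =>
    obtain ⟨q, _, hq⟩ := h.contracting d
    change IsCompact (Set.range (D.map d))
    exact isCompact_range hq.continuous
  | node d ts ih =>
    rw [range_treeMap_node]
    obtain ⟨q, _, hq⟩ := h.contracting d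
    exact (isCompact_univ_pi ih).image hq.continuous

theorem IsDigitSpace.range_treeMap_nonempty (h : D.IsDigitSpace) (S : FinTree D.ar) :
    (Set.range (D.treeMap S)).Nonempty := by
  obtain ⟨x⟩ := h.nonempty
  exact ⟨_, fun _ => x, rfl⟩

theorem dist_le_of_mem_range_init {q : NNReal} (hq : ∀ d, LipschitzWith q (D.map d)) {M : ℝ}
    (hM : ∀ x y : X, dist x y ≤ M) (n : ℕ) (T : InfTree D.ar) {x y : X}
    (hx : x ∈ Set.range (D.treeMap (T.init n))) (hy : y ∈ Set.range (D.treeMap (T.init n))) :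
    dist x y ≤ q ^ n * M := by
  induction n generalizing T x y with
  | zero => simpa using hM x y
  | succ n ih =>
    rw [InfTree.init, range_treeMap_node] at hx hy
    obtain ⟨a, ha, rfl⟩ := hx
    obtain ⟨b, hb, rfl⟩ := hy
    have hM0 : 0 ≤ M := dist_nonneg.trans (hM (D.map _ a) (D.map _ b))
    refine ((hq _).dist_le_mul a b).trans ?_
    rw [pow_succ', mul_assoc]
    refine mul_le_mul_of_nonneg_left ?_ q.2
    exact (dist_pi_le_iff (by positivity)).2 fun i =>
      ih (T.subtree i) (ha i (Set.mem_univ i)) (hb i (Set.mem_univ i))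

theorem IsDigitSpace.existsUnique_value (h : D.IsDigitSpace) (T : InfTree D.ar) :
    ∃! x : X, x ∈ ⋂ n, Set.range (D.treeMap (T.init n)) := by
  have := h.compact
  obtain ⟨x, hx⟩ := IsCompact.nonempty_iInter_of_sequence_nonempty_isCompact_isClosed
    (fun n => Set.range (D.treeMap (T.init n)))
    (fun n => range_treeMap_init_succ n T)
    (fun n => h.range_treeMap_nonempty _)
    (h.isCompact_range_treeMap _)
    (fun n => (h.isCompact_range_treeMap _).isClosed)
  refine ⟨x, hx, fun y hy => ?_⟩
  obtain ⟨q, hq1, hq⟩ := h.exists_factor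
  obtain ⟨M, hM⟩ := Metric.isBounded_iff.1 (isCompact_univ (X := X)).isBounded
  have hle : ∀ n : ℕ, dist y x ≤ (q : ℝ) ^ n * M := fun n =>
    dist_le_of_mem_range_init hq (fun a b => hM (Set.mem_univ a) (Set.mem_univ b)) n T
      (Set.mem_iInter.1 hy n) (Set.mem_iInter.1 hx n)
  have hlim : Filter.Tendsto (fun n : ℕ => (q : ℝ) ^ n * M) Filter.atTop (nhds 0) := by
    simpa using (tendsto_pow_atTop_nhds_zero_of_lt_one q.2 (by exact_mod_cast hq1)).mul_const M
  exact dist_le_zero.1 (ge_of_tendsto' hlim hle)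

/-- The coding map: `⟦T⟧` is the unique element of `⋂ n, range f_{T^(n)}`. -/
noncomputable def IsDigitSpace.val (h : D.IsDigitSpace) (T : InfTree D.ar) : X :=
  (h.existsUnique_value T).choose

end Value

/-! ### Computability

The countable dense set of basic elements is given by a type `Q` of finite objects (a
`Primcodable` type, on which computability is Mathlib's) and the map `ι : Q → X` with dense range
that sends a finite object to the basic element it denotes. It need not be injective, so `Q` may
be an honest countable subset with `ι` the inclusion, as well as `ℕ` with `ι` an enumeration of the
basic elements, with repetitions. -/

section Computability

variable [MetricSpace X] {Q : Type v} [Primcodable Q]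

/-- The metric space `X` is computable with respect to the basic elements. -/
structure _root_.IsComputableMetric (ι : Q → X) : Prop where
  dense : DenseRange ι
  lt_re : REPred fun p : Q × Q × (ℕ × ℕ × ℕ) => dist (ι p.1) (ι p.2.1) < (ratVal p.2.2 : ℝ)
  gt_re : REPred fun p : Q × Q × (ℕ × ℕ × ℕ) => (ratVal p.2.2 : ℝ) < dist (ι p.1) (ι p.2.1)

/-- A map `f : X^k → X` is computable: it has a computable modulus of (uniform) continuity, and
one can compute its values on basic elements with any prescribed precision. -/
def _root_.IsComputableMap (ι : Q → X) {k : ℕ} (f : (Fin k → X) → X) : Prop :=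
  (∃ ζ : ℕ × ℕ → ℕ × ℕ, Computable ζ ∧
    ∀ (ε : ℕ × ℕ) (x y : Fin k → X),
      dist x y < (posRat (ζ ε) : ℝ) → dist (f x) (f y) < (posRat ε : ℝ)) ∧
  ∃ g : (Fin k → Q) × ℕ → Q, Computable g ∧
    ∀ (a : Fin k → Q) (n : ℕ), dist (f fun i => ι (a i)) (ι (g (a, n))) < (1 / 2 : ℝ) ^ n

/-- `(X, D, Q)` is a computable digit space. -/
structure IsComputableDigitSpace (D : DigitSystem X m) (ι : Q → X) : Prop where
  isDigitSpace : D.IsDigitSpace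
  computableMetric : IsComputableMetric ι
  computable_map : ∀ d, IsComputableMap ι (D.map d)

/-- It is decidable whether a ball with a basic element as centre and a positive rational radius
is contained in the range of a given digit. -/
def IsDecidable (D : DigitSystem X m) (ι : Q → X) : Prop :=
  ∀ d, ComputablePred fun p : Q × (ℕ × ℕ) =>
    Metric.ball (ι p.1) (posRat p.2 : ℝ) ⊆ Set.range (D.map d)

/-- Approximable choice. The procedure `(θ, a) ↦ v (θ, a)` has to be defined only for basic
elements in the interior of the range of the digit; the function `θ ↦ θ'` of the second condition
is `μ`. -/
def HasApproximableChoice (D : DigitSystem X m) (ι : Q → X) : Prop :=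
  ∀ d, ∃ v : (ℕ × ℕ) × Q →. (Fin (D.ar d) → Q), Partrec v ∧
    (∀ (θ : ℕ × ℕ) (a : Q), ι a ∈ interior (Set.range (D.map d)) → (v (θ, a)).Dom) ∧
    (∀ (θ θ₁ : ℕ × ℕ) (a : Q), ι a ∈ interior (Set.range (D.map d)) →
      ∀ b ∈ v (θ, a), ∀ c ∈ v (θ₁, a),
        dist (fun i => ι (b i)) (fun i => ι (c i)) < max (posRat θ : ℝ) (posRat θ₁ : ℝ)) ∧
    (∃ μ : ℕ × ℕ → ℕ × ℕ, Computable μ ∧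
      ∀ (θ : ℕ × ℕ) (a a' : Q), ι a ∈ interior (Set.range (D.map d)) →
        ι a' ∈ interior (Set.range (D.map d)) →
        dist (ι a) (ι a') < (posRat (μ θ) : ℝ) →
        ∀ b ∈ v (θ, a), ∀ c ∈ v (θ, a'),
          dist (fun i => ι (b i)) (fun i => ι (c i)) < (posRat θ : ℝ)) ∧
    (∀ (θ : ℕ × ℕ) (a : Q), ι a ∈ interior (Set.range (D.map d)) →
      ∀ b ∈ v (θ, a), ∃ y : Fin (D.ar d) → X,
        D.map d y = ι a ∧ dist y (fun i => ι (b i)) < (posRat θ : ℝ))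

end Computability

end DigitSystem

/-! ### Type-two computability and representations -/

/-- Let the elements of `A` and `B` be named by infinite sequences of finite objects. A partial
operator `H` from `A` to `B` is computable if there is a computable `φ` which, from a finite
prefix of the name of `a` in the domain of `H`, and `n`, produces nothing or the `n`-th term of the
name of `H a`, and does produce the latter from some sufficiently long prefix. -/
def IsComputableOperator {A B : Type*} {α β : Type*} [Primcodable α] [Primcodable β]
    (nameA : A → ℕ → α) (nameB : B → ℕ → β) (H : A →. B) : Prop :=
  ∃ φ : List α × ℕ → Option β, Computable φ ∧
    ∀ (a : A) (b : B), b ∈ H a → ∀ n : ℕ,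
      (∃ k, φ ((List.range k).map (nameA a), n) = some (nameB b n)) ∧
      ∀ k y, φ ((List.range k).map (nameA a), n) = some y → y = nameB b n

/-- Reducibility of representations of `X`: names with respect to `δ` can computably be translated
into names, with respect to `γ`, of the same point. -/
def RepReducible {X α β : Type*} [Primcodable α] [Primcodable β]
    (δ : (ℕ → α) →. X) (γ : (ℕ → β) →. X) : Prop :=
  ∃ H : (ℕ → α) →. (ℕ → β), IsComputableOperator id id H ∧
    ∀ p, ∀ x ∈ δ p, ∃ p' ∈ H p, x ∈ γ p'

/-- Computable equivalence of representations. -/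
def RepEquiv {X α β : Type*} [Primcodable α] [Primcodable β]
    (δ : (ℕ → α) →. X) (γ : (ℕ → β) →. X) : Prop :=
  RepReducible δ γ ∧ RepReducible γ δ

/-- The Cauchy representation `ρ_C`: the sequence `w` of basic elements denotes the (unique) point
`x` with `ρ(x, w_n) < 2^{-n}` for all `n`, if there is one. -/
noncomputable def cauchyRep {X : Type u} [MetricSpace X] {Q : Type v} (ι : Q → X) :
    (ℕ → Q) →. X :=
  fun w => ⟨∃ x, ∀ n : ℕ, dist x (ι (w n)) < (1 / 2 : ℝ) ^ n, fun h => h.choose⟩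

/-- The tree representation: the stream `T^(0) : T^(1) : ⋯` denotes `⟦T⟧`. -/
noncomputable def treeRep {X : Type u} [MetricSpace X] {m : ℕ} {D : DigitSystem X m}
    (h : D.IsDigitSpace) : (ℕ → List (List ℕ × Fin m)) →. X :=
  fun p => ⟨∃ T : InfTree D.ar, T.stream = p, fun hp => h.val hp.choose⟩

/-!
A tree is translated into a name by evaluating it up to a height `J`, with the subtrees at height
`J` replaced by one basic element and every digit evaluated up to an error `ε`. Since the digits
contract by a common factor `q < 1`, the result has distance at most `q ^ J * diam X + J * ε` from
the value of the tree.

For the converse, a Lebesgue number of the covering of `X` by the interiors of the ranges shows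
that a fixed term of a name of `x` determines a digit `d` whose range contains a ball around `x`
of a radius that does not depend on `x`. Along the name of `x`, approximate choice for `d` with
increasing precision gives a Cauchy sequence, because it depends uniformly continuously on the
basic element and its values with different precisions are close together. The limit `y` satisfies
`d y = x`, and names of the components of `y` have been computed on the way. Iterating this step
unfolds the name into a tree; each of its initial segments depends on a finite prefix of the name.
-/

section ComputableFunctions

variable {α β σ : Type*} [Primcodable α] [Primcodable β] [Primcodable σ]

theorem computable_uncurry_fin {m : ℕ} {f : Fin m → α → σ} (hf : ∀ d, Computable (f d)) :
    Computable fun p : Fin m × α => f p.1 p.2 :=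
  Computable.option_some_iff.1 <|
    (Computable.list_getElem?.comp ((Computable.list_ofFn hf).comp Computable.snd)
      (Primrec.fin_val.to_comp.comp Computable.fst)).of_eq fun p => by simp

theorem computable_list_foldl {f : α → List β} {g : α → σ} {h : α → σ × β → σ}
    (hf : Computable f) (hg : Computable g) (hh : Computable₂ h) :
    Computable fun a => (f a).foldl (fun s b => h a (s, b)) (g a) := by
  refine (Computable.nat_rec (h := fun a (p : ℕ × σ) =>
    Option.casesOn ((f a)[p.1]?) p.2 fun b => h a (p.2, b))
    (Computable.list_length.comp hf) hg ?_).of_eq fun a => ?_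
  · exact Computable.option_casesOn
      (Computable.list_getElem?.comp (hf.comp Computable.fst)
        (Computable.fst.comp Computable.snd))
      (Computable.snd.comp Computable.snd)
      (hh.comp (Computable.fst.comp Computable.fst)
        ((Computable.snd.comp (Computable.snd.comp Computable.fst)).pair Computable.snd)).to₂
  · have rec_eq_foldl_take (n : ℕ) :
        (Nat.rec (g a) (fun n s => Option.casesOn ((f a)[n]?) s fun b => h a (s, b)) n : σ) =
          ((f a).take n).foldl (fun s b => h a (s, b)) (g a) := by
      induction n with
      | zero => simp
      | succ n ih =>
        simp only [ih, List.take_add_one, List.foldl_append]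
        cases (f a)[n]? <;> rfl
    rw [rec_eq_foldl_take, List.take_length]

theorem computable_list_foldr {f : α → List β} {g : α → σ} {h : α → β × σ → σ}
    (hf : Computable f) (hg : Computable g) (hh : Computable₂ h) :
    Computable fun a => (f a).foldr (fun b s => h a (b, s)) (g a) := by
  simp only [List.foldr_eq_foldl_reverse]
  exact computable_list_foldl (h := fun a p => h a p.swap) (Computable.list_reverse.comp hf) hg
    (hh.comp Computable.fst
      ((Computable.snd.comp Computable.snd).pair (Computable.fst.comp Computable.snd)))

theorem computable_list_map {f : α → List β} {g : α → β → σ} (hf : Computable f)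
    (hg : Computable₂ g) : Computable fun a => (f a).map (g a) := by
  simp only [List.map_eq_foldr]
  exact computable_list_foldr (h := fun a p => g a p.1 :: p.2) hf (Computable.const [])
    (Computable.list_cons.comp (hg.comp Computable.fst (Computable.fst.comp Computable.snd))
      (Computable.snd.comp Computable.snd))

theorem computable_list_flatMap {f : α → List β} {g : α → β → List σ} (hf : Computable f)
    (hg : Computable₂ g) : Computable fun a => (f a).flatMap (g a) :=
  Primrec.list_flatten.to_comp.comp (computable_list_map hf hg)

theorem exists_computable_choice {P : β × α → Prop} (hP : ComputablePred P)
    (h : ∀ a, ∃ b, P (b, a)) : ∃ f : α → β, Computable f ∧ ∀ a, P (f a, a) := by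
  obtain ⟨t, ht, rfl⟩ := ComputablePred.computable_iff.1 hP
  let isWitness (a : α) (n : ℕ) : Bool :=
    (Encodable.decode n : Option β).any fun b => t (b, a)
  have hwitness : Computable₂ isWitness :=
    (Computable.option_casesOn (Computable.decode.comp Computable.snd) (Computable.const false)
      (ht.comp (Computable.snd.pair (Computable.fst.comp Computable.fst))).to₂).of_eq fun p => by
        cases h : (Encodable.decode p.2 : Option β) <;> simp [isWitness, h]
  have hex (a : α) : ∃ n, isWitness a n = true := by
    obtain ⟨b, hb⟩ := h a
    exact ⟨Encodable.encode b, by simpa [isWitness] using hb⟩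
  have hfind : Computable fun a => Nat.find (hex a) :=
    Computable.find (P := fun a n => isWitness a n = true)
      (ComputablePred.computable_iff.2 ⟨_, hwitness, rfl⟩) hex
  have hdecode (a : α) : ∃ b, Encodable.decode (Nat.find (hex a)) = some b ∧ t (b, a) :=
    (Option.any_eq_true _ _).1 (Nat.find_spec (hex a))
  choose f hf ht using hdecode
  exact ⟨f, Computable.option_some_iff.1 ((Computable.decode.comp hfind).of_eq hf), ht⟩

theorem exists_computable_mem_of_partrec [Nonempty σ] {f : α →. σ} (hf : Partrec f)
    {P : α → Prop} (hP : ComputablePred P) (hdom : ∀ a, P a → (f a).Dom) :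
    ∃ g : α → σ, Computable g ∧ ∀ a, P a → g a ∈ f a := by
  obtain ⟨t, ht, rfl⟩ := ComputablePred.computable_iff.1 hP
  obtain ⟨s₀⟩ := ‹Nonempty σ›
  have hmem (a : α) : ∃ s, s ∈ bif t a then f a else Part.some s₀ := by
    cases hta : t a with
    | false => exact ⟨s₀, Part.mem_some s₀⟩
    | true => exact Part.dom_iff_mem.1 (hdom a hta)
  choose g hg using hmem
  exact ⟨g, (Partrec.cond ht hf (Computable.const s₀)).of_eq_tot hg,
    fun a hta => by simpa only [hta, cond_true] using hg a⟩

theorem exists_computable_strictMono_ge {κ : ℕ → ℕ} (hκ : Computable κ) :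
    ∃ K : ℕ → ℕ, Computable K ∧ StrictMono K ∧ ∀ n, κ n ≤ K n := by
  let K (n : ℕ) : ℕ := Nat.rec (κ 0) (fun n k => k + (κ (n + 1) + 1)) n
  refine ⟨K, ?_, strictMono_nat_of_lt_succ fun n => Nat.lt_add_of_pos_right (Nat.succ_pos _), ?_⟩
  · refine Computable.nat_rec (h := fun _ p => p.2 + (κ (p.1 + 1) + 1))
      Computable.id (Computable.const _) ?_
    exact Primrec.nat_add.to_comp.comp (Computable.snd.comp Computable.snd) (Computable.succ.comp
      (hκ.comp (Computable.succ.comp (Computable.fst.comp Computable.snd))))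
  · rintro (_ | n)
    · exact le_rfl
    · exact (Nat.le_succ _).trans (Nat.le_add_left _ _)

theorem exists_computable_strictMono_ge_family {m : ℕ} {κ : Fin m → ℕ → ℕ}
    (hκ : ∀ d, Computable (κ d)) :
    ∃ K : ℕ → ℕ, Computable K ∧ StrictMono K ∧ ∀ d n, κ d n ≤ K n := by
  have hsum : Computable fun n => (List.ofFn fun d => κ d n).sum :=
    computable_list_foldr (h := fun _ p => p.1 + p.2) (Computable.list_ofFn hκ)
      (Computable.const 0) (Primrec.nat_add.to_comp.comp (Computable.fst.comp Computable.snd)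
        (Computable.snd.comp Computable.snd))
  obtain ⟨K, hK, hmono, hle⟩ := exists_computable_strictMono_ge hsum
  exact ⟨K, hK, hmono, fun d n =>
    (List.le_sum_of_mem (List.mem_ofFn.2 ⟨d, rfl⟩)).trans (hle n)⟩

end ComputableFunctions

section Operators

variable {X A B α β : Type*} [Primcodable α] [Primcodable β] {nameA : A → ℕ → α}
  {nameB : B → ℕ → β}

theorem IsComputableOperator.mono {H H' : A →. B} (hH : IsComputableOperator nameA nameB H)
    (hle : ∀ a, ∀ b ∈ H' a, b ∈ H a) : IsComputableOperator nameA nameB H' := by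
  obtain ⟨φ, hφ, hspec⟩ := hH
  exact ⟨φ, hφ, fun a b hb => hspec a b (hle a b hb)⟩

theorem isComputableOperator_of_prefix {F : A → B} {φ : List α × ℕ → β} {N : ℕ → ℕ}
    (hφ : Computable φ) (hN : Computable N)
    (h : ∀ a n, φ ((List.range (N n)).map (nameA a), n) = nameB (F a) n) :
    IsComputableOperator nameA nameB (F : A →. B) := by
  refine ⟨fun p => bif decide (N p.2 ≤ p.1.length) then some (φ (p.1.take (N p.2), p.2)) else none,
    ?_, fun a b hb n => ?_⟩
  · have hN₂ : Computable fun p : List α × ℕ => N p.2 := hN.comp Computable.snd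
    exact Computable.cond
      (Primrec.nat_le.decide.to_comp.comp hN₂ (Computable.list_length.comp Computable.fst))
      (Computable.option_some.comp (hφ.comp ((Primrec.list_take.to_comp.comp hN₂
        Computable.fst).pair Computable.snd)))
      (Computable.const none)
  · obtain rfl := Part.mem_some_iff.1 hb
    have hlong {k : ℕ} (hk : N n ≤ k) :
        φ (((List.range k).map (nameA a)).take (N n), n) = nameB (F a) n := by
      rw [← List.map_take, List.take_range, min_eq_left hk, h]
    refine ⟨⟨N n, by simp [hlong le_rfl]⟩, fun k y hy => ?_⟩
    by_cases hk : N n ≤ k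
    · simpa [hk, hlong hk, eq_comm] using hy
    · simp [hk] at hy

theorem RepReducible.of_isComputableOperator {δ : (ℕ → α) →. X} {γ : (ℕ → β) →. X} {F : A → B}
    (hF : IsComputableOperator nameA nameB (F : A →. B))
    (h : ∀ p, ∀ x ∈ δ p, ∃ a, nameA a = p ∧ x ∈ γ (nameB (F a))) : RepReducible δ γ := by
  obtain ⟨φ, hφ, hspec⟩ := hF
  refine ⟨fun p => ⟨∃ a, nameA a = p ∧ ∀ x ∈ δ p, x ∈ γ (nameB (F a)),
    fun hp => nameB (F hp.choose)⟩, ⟨φ, hφ, ?_⟩, fun p x hx => ?_⟩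
  · rintro p _ ⟨hp, rfl⟩
    have := hspec hp.choose _ (Part.mem_some _)
    rwa [hp.choose_spec.1] at this
  · obtain ⟨a, ha, hax⟩ := h p x hx
    have hp : ∃ a, nameA a = p ∧ ∀ x ∈ δ p, x ∈ γ (nameB (F a)) :=
      ⟨a, ha, fun x' hx' => Part.mem_unique hx hx' ▸ hax⟩
    exact ⟨_, ⟨hp, rfl⟩, hp.choose_spec.2 x hx⟩

end Operators

namespace InfTree

variable {m : ℕ} {ar : Fin m → ℕ}

theorem stream_zero (T : InfTree ar) : T.stream 0 = [([], T.root)] := rfl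

theorem stream_succ (T : InfTree ar) (n : ℕ) :
    T.stream (n + 1) = ([], T.root) :: (List.ofFn fun i : Fin (ar T.root) =>
      ((T.subtree i).stream n).map fun p => ((i : ℕ) :: p.1, p.2)).flatten := rfl

theorem lt_ar_root_of_label_cons (T : InfTree ar) {i : ℕ} {s : List ℕ}
    (h : (T.label (i :: s)).isSome) : i < ar T.root := by
  induction s using List.reverseRecOn with
  | nil =>
    obtain ⟨d, hd, hi⟩ := (T.mem_snoc [] i).1 h
    rw [T.label_nil, Option.some.injEq] at hd
    rwa [hd]
  | append_singleton s j ih =>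
    obtain ⟨d, hd, -⟩ := (T.mem_snoc (i :: s) j).1 h
    exact ih (by simp [hd])

theorem mem_stream (T : InfTree ar) {n : ℕ} {s : List ℕ} {d : Fin m} :
    (s, d) ∈ T.stream n ↔ s.length ≤ n ∧ T.label s = some d := by
  induction n generalizing T s with
  | zero =>
    simp only [stream_zero, List.mem_singleton, Prod.mk.injEq, Nat.le_zero,
      List.length_eq_zero_iff]
    refine and_congr_right ?_
    rintro rfl
    rw [T.label_nil, Option.some.injEq, eq_comm]
  | succ n ih =>
    rw [stream_succ]
    cases s with
    | nil => simp [T.label_nil, eq_comm]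
    | cons i s =>
      simp only [List.mem_cons, Prod.mk.injEq, reduceCtorEq, false_and, List.mem_flatten,
        List.mem_ofFn, List.mem_map, Prod.exists, false_or, exists_exists_eq_and, List.cons.injEq,
        List.length_cons, Nat.add_le_add_iff_right]
      constructor
      · rintro ⟨j, s', d', h, ⟨rfl, rfl⟩, rfl⟩
        exact (ih _).1 h
      · rintro ⟨hlen, hlabel⟩
        exact ⟨⟨i, T.lt_ar_root_of_label_cons (Option.isSome_iff_exists.2 ⟨d, hlabel⟩)⟩, s, d,
          (ih _).2 ⟨hlen, hlabel⟩, ⟨rfl, rfl⟩, rfl⟩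

theorem stream_injective : Function.Injective (stream (ar := ar)) := by
  intro T T' h
  ext s d
  have hT := (T.mem_stream (n := s.length) (s := s) (d := d)).symm
  rw [h, T'.mem_stream] at hT
  simpa using hT

/-! ### Trees of the runs of an automaton -/

section Unfold

variable {S S' : Type*}

/-- The labelling of `InfTree.unfold`. -/
def unfoldLabel (ar : Fin m → ℕ) (lab : S → Fin m) (next : S → ℕ → S) :
    S → List ℕ → Option (Fin m)
  | s, [] => some (lab s)
  | s, i :: l => if i < ar (lab s) then unfoldLabel ar lab next (next s i) l else none

/-- The tree of the runs, from the state `s`, of an automaton: a node in state `s` carries the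
label `lab s`, and its `i`-th child is in state `next s i`. -/
def unfold (ar : Fin m → ℕ) (lab : S → Fin m) (next : S → ℕ → S) (s : S) : InfTree ar where
  label := unfoldLabel ar lab next s
  root_mem := rfl
  mem_snoc l j := by
    induction l generalizing s with
    | nil => simp [unfoldLabel]
    | cons i l ih =>
      simp only [List.cons_append, unfoldLabel]
      split_ifs with h
      · exact ih (next s i)
      · simp

theorem subtree_unfold (lab : S → Fin m) (next : S → ℕ → S) (s : S) (i : Fin (ar (lab s))) :
    (unfold ar lab next s).subtree i = unfold ar lab next (next s i) := by
  ext1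
  funext l
  exact if_pos i.2

theorem stream_unfold_succ (lab : S → Fin m) (next : S → ℕ → S) (s : S) (n : ℕ) :
    (unfold ar lab next s).stream (n + 1) = ([], lab s) :: (List.range (ar (lab s))).flatMap
      fun i => ((unfold ar lab next (next s i)).stream n).map fun p => (i :: p.1, p.2) := by
  rw [stream_succ, List.flatMap_def, ← List.map_coe_finRange_eq_range, List.map_map,
    ← List.ofFn_eq_map]
  exact congrArg (fun f => ([], lab s) :: (List.ofFn f).flatten) (funext fun i =>
    congrArg (fun T : InfTree ar => (T.stream n).map fun p => ((i : ℕ) :: p.1, p.2))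
      (subtree_unfold lab next s i))

theorem stream_unfold_eq_of_rel {lab : S → Fin m} {next : S → ℕ → S} {lab' : S' → Fin m}
    {next' : S' → ℕ → S'} {R : ℕ → S → S' → Prop} (hlab : ∀ n s s', R n s s' → lab s = lab' s')
    (hnext : ∀ n s s' i, R (n + 1) s s' → R n (next s i) (next' s' i)) {n : ℕ} {s : S} {s' : S'}
    (h : R n s s') : (unfold ar lab next s).stream n = (unfold ar lab' next' s').stream n := by
  induction n generalizing s s' with
  | zero => exact congrArg (fun d => [([], d)]) (hlab 0 s s' h)
  | succ n ih => simp only [stream_unfold_succ, hlab _ s s' h, fun i => ih (hnext n s s' i h)]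

/-- The children of the nodes in the last generation are inserted behind these nodes. -/
def expandStates (ar : Fin m → ℕ) (lab : S → Fin m) (next : S → ℕ → S) (n : ℕ)
    (q : List ℕ × S) : List (List ℕ × S) :=
  q :: if q.1.length = n then
    (List.range (ar (lab q.2))).map fun i => (q.1 ++ [i], next q.2 i) else []

/-- The nodes of `InfTree.unfold` up to height `n`, in depth-first order, with their states. Unlike
the recursion on subtrees that defines `InfTree.init`, this recursion calls itself only at the
same state, and so is an instance of primitive recursion on `n`. -/
def unfoldStates (ar : Fin m → ℕ) (lab : S → Fin m) (next : S → ℕ → S) (s : S) :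
    ℕ → List (List ℕ × S)
  | 0 => [([], s)]
  | n + 1 => (unfoldStates ar lab next s n).flatMap (expandStates ar lab next n)

theorem unfoldStates_succ_eq_cons (lab : S → Fin m) (next : S → ℕ → S) (s : S) (n : ℕ) :
    unfoldStates ar lab next s (n + 1) = ([], s) :: (List.range (ar (lab s))).flatMap fun i =>
      (unfoldStates ar lab next (next s i) n).map fun q => (i :: q.1, q.2) := by
  induction n with
  | zero => simp [unfoldStates, expandStates, List.map_eq_flatMap]
  | succ n ih =>
    have expandStates_cons (i : ℕ) (q : List ℕ × S) :
        expandStates ar lab next (n + 1) (i :: q.1, q.2) =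
          (expandStates ar lab next n q).map fun q => (i :: q.1, q.2) := by
      simp only [expandStates, List.length_cons, Nat.add_right_cancel_iff, List.map_cons,
        List.cons_append]
      split_ifs <;> simp
    rw [unfoldStates, ih]
    simp only [List.flatMap_cons, List.flatMap_assoc, List.flatMap_map, List.map_flatMap,
      expandStates_cons, unfoldStates]
    simp [expandStates]

theorem stream_unfold (lab : S → Fin m) (next : S → ℕ → S) (s : S) (n : ℕ) :
    (unfold ar lab next s).stream n =
      (unfoldStates ar lab next s n).map fun q => (q.1, lab q.2) := by
  induction n generalizing s with
  | zero => rfl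
  | succ n ih =>
    simp only [stream_unfold_succ, unfoldStates_succ_eq_cons, ih, List.map_cons, List.map_flatMap,
      List.map_map, Function.comp_def]

variable [Primcodable S] {lab : S → Fin m} {next : S → ℕ → S}

theorem computable_expandStates (hlab : Computable lab) (hnext : Computable₂ next) :
    Computable₂ (expandStates ar lab next) := by
  have hpath : Computable fun p : ℕ × List ℕ × S => p.2.1 := Computable.fst.comp Computable.snd
  have hstate : Computable fun p : ℕ × List ℕ × S => p.2.2 := Computable.snd.comp Computable.snd
  have hlast : Computable fun p : ℕ × List ℕ × S => decide (p.2.1.length = p.1) :=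
    Primrec.eq.decide.to_comp.comp (Computable.list_length.comp hpath) Computable.fst
  have harity : Computable fun p : ℕ × List ℕ × S => ar (lab p.2.2) :=
    (Primrec.dom_finite ar).to_comp.comp (hlab.comp hstate)
  refine Computable.list_cons.comp Computable.snd ?_
  refine (Computable.cond hlast (computable_list_map (Primrec.list_range.to_comp.comp harity) ?_)
    (Computable.const [])).of_eq fun p => Bool.cond_decide _ _ _
  exact (Computable.list_concat.comp (hpath.comp Computable.fst) Computable.snd).pair
    (hnext.comp (hstate.comp Computable.fst) Computable.snd)

theorem computable_unfoldStates (hlab : Computable lab) (hnext : Computable₂ next) :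
    Computable₂ (unfoldStates ar lab next) := by
  refine (Computable.nat_rec (h := fun _ q => q.2.flatMap (expandStates ar lab next q.1))
    Computable.snd (Computable.list_cons.comp ((Computable.const []).pair Computable.fst)
      (Computable.const [])) ?_).of_eq fun p => ?_
  · exact computable_list_flatMap (Computable.snd.comp Computable.snd)
      ((computable_expandStates hlab hnext).comp
        (Computable.fst.comp (Computable.snd.comp Computable.fst)) Computable.snd)
  · induction p.2 with
    | zero => rfl
    | succ n ih => simp only [ih, unfoldStates]

theorem computable_stream_unfold (hlab : Computable lab) (hnext : Computable₂ next) :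
    Computable₂ fun s n => (unfold ar lab next s).stream n := by
  simp only [stream_unfold]
  exact computable_list_map (computable_unfoldStates hlab hnext)
    ((Computable.fst.comp Computable.snd).pair (hlab.comp (Computable.snd.comp Computable.snd)))

end Unfold

/-- How many terms of a sequence have to be read for the tree of height `n`, if the `n`-th term of
the sequence of a child depends on the terms with the numbers `k₀` and `K n` of its parent. -/
def prefixLength (k₀ : ℕ) (K : ℕ → ℕ) : ℕ → ℕ
  | 0 => k₀ + 1
  | n + 1 => K (prefixLength k₀ K n)

theorem lt_prefixLength (k₀ : ℕ) {K : ℕ → ℕ} (hK : StrictMono K) (n : ℕ) :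
    k₀ < prefixLength k₀ K n := by
  induction n with
  | zero => exact k₀.lt_succ_self
  | succ n ih => exact ih.trans_le hK.le_apply

theorem computable_prefixLength (k₀ : ℕ) {K : ℕ → ℕ} (hK : Computable K) :
    Computable (prefixLength k₀ K) :=
  (Computable.nat_rec (h := fun _ p => K p.2) Computable.id (Computable.const (k₀ + 1))
    (hK.comp (Computable.snd.comp Computable.snd))).of_eq fun n => by
      induction n with
      | zero => rfl
      | succ n ih => exact congrArg K ih

theorem isComputableOperator_unfold {Q : Type*} [Primcodable Q] [Nonempty Q] (ar : Fin m → ℕ)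
    (k₀ : ℕ) {K : ℕ → ℕ} {lab : Q → Fin m} {next : (Q × ℕ) × ℕ × Q → Q} (hK : Computable K)
    (hKmono : StrictMono K) (hlab : Computable lab) (hnext : Computable next) :
    IsComputableOperator id stream ((unfold ar (fun w => lab (w k₀))
      fun w i n => next ((w k₀, i), n, w (K n)) : (ℕ → Q) → InfTree ar) :
        (ℕ → Q) →. InfTree ar) := by
  obtain ⟨u⟩ := ‹Nonempty Q›
  -- The same automaton, with a state represented by an initial segment of it.
  let labList (l : List Q) : Fin m := lab (l[k₀]?.getD u)
  let nextList (l : List Q) (i : ℕ) : List Q :=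
    (List.range l.length).map fun n => next ((l[k₀]?.getD u, i), n, l[K n]?.getD u)
  have hget : Computable₂ fun (l : List Q) (k : ℕ) => l[k]?.getD u :=
    Computable.option_getD Computable.list_getElem? (Computable.const u)
  have hlabList : Computable labList := hlab.comp (hget.comp Computable.id (Computable.const k₀))
  have hnextList : Computable₂ nextList := by
    refine computable_list_map
      (Primrec.list_range.to_comp.comp (Computable.list_length.comp Computable.fst)) ?_
    have hlist : Computable fun p : (List Q × ℕ) × ℕ => p.1.1 :=
      Computable.fst.comp Computable.fst
    exact hnext.comp (((hget.comp hlist (Computable.const k₀)).pair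
      (Computable.snd.comp Computable.fst)).pair
        (Computable.snd.pair (hget.comp hlist (hK.comp Computable.snd))))
  refine isComputableOperator_of_prefix (computable_stream_unfold (ar := ar) hlabList hnextList)
    (computable_prefixLength k₀ hK) fun w n => ?_
  let Agree (n : ℕ) (l : List Q) (w : ℕ → Q) : Prop :=
    ∀ k < prefixLength k₀ K n, l[k]? = some (w k)
  have get_eq {n l w} (h : Agree n l w) : l[k₀]?.getD u = w k₀ := by
    rw [h k₀ (lt_prefixLength k₀ hKmono n), Option.getD_some]
  refine stream_unfold_eq_of_rel (R := Agree) (fun n l w h => congrArg lab (get_eq h))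
    (fun n l w i h k hk => ?_) fun k hk => by simp [hk]
  have hKk : l[K k]? = some (w (K k)) := h _ (hKmono hk)
  have hlength : k < l.length := hKmono.le_apply.trans_lt (List.getElem?_eq_some_iff.1 hKk).1
  simp [nextList, hlength, get_eq h, hKk]

end InfTree

section CauchyNames

variable {X : Type u} [MetricSpace X] {Q : Type v} {ι : Q → X} {w : ℕ → Q} {x y : X}

/-- The sequence `w` of codes of basic elements is a name of the point `x` in the Cauchy
representation. -/
def IsCauchyName (ι : Q → X) (w : ℕ → Q) (x : X) : Prop :=
  ∀ n : ℕ, dist x (ι (w n)) < (1 / 2 : ℝ) ^ n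

namespace IsCauchyName

theorem tendsto (h : IsCauchyName ι w x) :
    Filter.Tendsto (fun n => ι (w n)) Filter.atTop (nhds x) := by
  refine tendsto_iff_dist_tendsto_zero.2 (squeeze_zero (fun _ => dist_nonneg) (fun n => ?_)
    (tendsto_pow_atTop_nhds_zero_of_lt_one (r := (1 / 2 : ℝ)) (by norm_num) (by norm_num)))
  rw [dist_comm]
  exact (h n).le

theorem unique (hx : IsCauchyName ι w x) (hy : IsCauchyName ι w y) : x = y :=
  tendsto_nhds_unique hx.tendsto hy.tendsto

theorem dist_lt (h : IsCauchyName ι w x) {j k : ℕ} (hjk : j ≤ k) :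
    dist (ι (w j)) (ι (w k)) < 2 * (1 / 2 : ℝ) ^ j := by
  have hpow : (1 / 2 : ℝ) ^ k ≤ (1 / 2) ^ j :=
    pow_le_pow_of_le_one (by norm_num) (by norm_num) hjk
  linarith [dist_triangle_left (ι (w j)) (ι (w k)) x, h j, h k]

end IsCauchyName

theorem mem_cauchyRep_iff : x ∈ cauchyRep ι w ↔ IsCauchyName ι w x := by
  constructor
  · rintro ⟨hdom, rfl⟩
    exact hdom.choose_spec
  · intro h
    have hdom : (cauchyRep ι w).Dom := ⟨x, h⟩
    exact ⟨hdom, IsCauchyName.unique hdom.choose_spec h⟩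

end CauchyNames

namespace DigitSystem

variable {X : Type u} {m : ℕ} [MetricSpace X] {D : DigitSystem X m}

namespace IsDigitSpace

theorem val_eq (h : D.IsDigitSpace) {T : InfTree D.ar} {x : X}
    (hx : ∀ n, x ∈ Set.range (D.treeMap (T.init n))) : h.val T = x :=
  (h.existsUnique_value T).unique (h.existsUnique_value T).choose_spec.1 (Set.mem_iInter.2 hx)

theorem val_mem_range_init (h : D.IsDigitSpace) (T : InfTree D.ar) (n : ℕ) :
    h.val T ∈ Set.range (D.treeMap (T.init n)) :=
  Set.mem_iInter.1 (h.existsUnique_value T).choose_spec.1 n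

theorem val_eq_map (h : D.IsDigitSpace) (T : InfTree D.ar) :
    h.val T = D.map T.root fun i => h.val (T.subtree i) := by
  refine h.val_eq fun n => ?_
  cases n with
  | zero => exact ⟨fun i => h.val (T.subtree i), rfl⟩
  | succ n =>
    rw [InfTree.init, range_treeMap_node]
    exact ⟨_, fun i _ => h.val_mem_range_init _ n, rfl⟩

theorem val_unfold (h : D.IsDigitSpace) {S : Type*} {lab : S → Fin m} {next : S → ℕ → S}
    {P : S → X → Prop}
    (hP : ∀ s x, P s x → ∃ y : Fin (D.ar (lab s)) → X, D.map (lab s) y = x ∧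
      ∀ i : Fin (D.ar (lab s)), P (next s i) (y i))
    {s : S} {x : X} (hs : P s x) : h.val (InfTree.unfold D.ar lab next s) = x := by
  refine h.val_eq fun n => ?_
  induction n generalizing s x with
  | zero =>
    obtain ⟨y, rfl, -⟩ := hP s x hs
    exact ⟨y, rfl⟩
  | succ n ih =>
    obtain ⟨y, rfl, hy⟩ := hP s x hs
    rw [InfTree.init, range_treeMap_node]
    refine ⟨y, fun i _ => ?_, rfl⟩
    have hi := ih (hy i)
    rwa [← InfTree.subtree_unfold lab next s i] at hi

theorem mem_treeRep_iff (h : D.IsDigitSpace) {p : ℕ → List (List ℕ × Fin m)} {x : X} :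
    x ∈ treeRep h p ↔ ∃ T : InfTree D.ar, T.stream = p ∧ h.val T = x := by
  constructor
  · rintro ⟨hdom, rfl⟩
    exact ⟨hdom.choose, hdom.choose_spec, rfl⟩
  · rintro ⟨T, rfl, rfl⟩
    have hdom : (treeRep h T.stream).Dom := ⟨T, rfl⟩
    exact ⟨hdom, congrArg h.val (InfTree.stream_injective hdom.choose_spec)⟩

end IsDigitSpace

end DigitSystem

/-! ### From trees to names -/

namespace InfTree

variable {m : ℕ} {ar : Fin m → ℕ} {Q : Type v}

/-- Approximate evaluation of the tree `T`, cut off at height `n`: the value of a list of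
arguments under a digit is computed by `g`, and the cut off subtrees are replaced by `u`. -/
def evalApprox (g : Fin m → List Q → Q) (u : Q) : ℕ → InfTree ar → Q
  | 0, _ => u
  | n + 1, T => g T.root (List.ofFn fun i => evalApprox g u n (T.subtree i))

/-- One step of the stack machine that performs `InfTree.evalApprox`. It reads the nodes of the
tree in reverse depth-first order, so that the values of the children of a node of height less
than `n` are on top of the stack when it is read. -/
def evalStep (ar : Fin m → ℕ) (g : Fin m → List Q → Q) (u : Q) (n : ℕ) (b : List ℕ × Fin m)
    (stack : List Q) : List Q :=
  if b.1.length < n then g b.2 (stack.take (ar b.2)) :: stack.drop (ar b.2) else u :: stack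

theorem foldr_evalStep_stream (g : Fin m → List Q → Q) (u : Q) (n : ℕ) (T : InfTree ar)
    (stack : List Q) :
    (T.stream n).foldr (evalStep ar g u n) stack = evalApprox g u n T :: stack := by
  induction n generalizing T stack with
  | zero => rfl
  | succ n ih =>
    have foldr_subtrees :
        (List.ofFn fun i : Fin (ar T.root) => ((T.subtree i).stream n).map fun p =>
          ((i : ℕ) :: p.1, p.2)).flatten.foldr (evalStep ar g u (n + 1)) stack =
        (List.ofFn fun i => evalApprox g u n (T.subtree i)) ++ stack := by
      have evalStep_cons (i : ℕ) (p : List ℕ × Fin m) :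
          evalStep ar g u (n + 1) (i :: p.1, p.2) = evalStep ar g u n p := by
        funext stack
        simp [evalStep]
      simp only [List.foldr_flatten, List.ofFn_eq_map, List.foldr_map, evalStep_cons, ih,
        List.foldr_cons_eq_append]
    rw [stream_succ, List.foldr_cons, foldr_subtrees]
    simp [evalStep, evalApprox]

theorem computable_foldr_evalStep [Primcodable Q] (ar : Fin m → ℕ) {g : (Fin m × List Q) × ℕ → Q}
    (hg : Computable g) (u : Q) :
    Computable fun a : List (List ℕ × Fin m) × ℕ × ℕ =>
      a.1.foldr (evalStep ar (fun d l => g ((d, l), a.2.2)) u a.2.1) [] := by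
  refine computable_list_foldr (h := fun (a : List (List ℕ × Fin m) × ℕ × ℕ)
    (p : (List ℕ × Fin m) × List Q) => evalStep ar (fun d l => g ((d, l), a.2.2)) u a.2.1 p.1 p.2)
    Computable.fst (Computable.const []) ?_
  let Input : Type _ := (List (List ℕ × Fin m) × ℕ × ℕ) × (List ℕ × Fin m) × List Q
  have hdigit : Computable fun p : Input => p.2.1.2 :=
    Computable.snd.comp (Computable.fst.comp Computable.snd)
  have hstack : Computable fun p : Input => p.2.2 := Computable.snd.comp Computable.snd
  have harity : Computable fun p : Input => ar p.2.1.2 :=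
    (Primrec.dom_finite ar).to_comp.comp hdigit
  have hinner : Computable fun p : Input => decide (p.2.1.1.length < p.1.2.1) :=
    Primrec.nat_lt.decide.to_comp.comp
      (Computable.list_length.comp (Computable.fst.comp (Computable.fst.comp Computable.snd)))
      (Computable.fst.comp (Computable.snd.comp Computable.fst))
  have hvalue : Computable fun p : Input => g ((p.2.1.2, p.2.2.take (ar p.2.1.2)), p.1.2.2) :=
    hg.comp ((hdigit.pair (Primrec.list_take.to_comp.comp harity hstack)).pair
      (Computable.snd.comp (Computable.snd.comp Computable.fst)))
  exact (Computable.cond hinner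
    (Computable.list_cons.comp hvalue (Primrec.list_drop.to_comp.comp harity hstack))
    (Computable.list_cons.comp (Computable.const u) hstack)).of_eq fun p => Bool.cond_decide _ _ _

end InfTree

namespace DigitSystem

variable {X : Type u} {m : ℕ} [MetricSpace X] {D : DigitSystem X m}

theorem IsDigitSpace.dist_val_evalApprox_le {Q : Type v} (h : D.IsDigitSpace) {ι : Q → X}
    {q : NNReal} (hq1 : q ≤ 1) (hq : ∀ d, LipschitzWith q (D.map d)) {M : ℝ}
    (hM : ∀ x y : X, dist x y ≤ M) {g : Fin m → List Q → Q} {u : Q} {ε : ℝ}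
    (hg : ∀ d l, dist (D.map d fun i => ι (l.getD i u)) (ι (g d l)) ≤ ε)
    (n : ℕ) (T : InfTree D.ar) :
    dist (h.val T) (ι (T.evalApprox g u n)) ≤ q ^ n * M + n * ε := by
  have hM0 : 0 ≤ M := dist_nonneg.trans (hM (h.val T) (h.val T))
  have hε0 : 0 ≤ ε := dist_nonneg.trans (hg T.root [])
  induction n generalizing T with
  | zero => simpa using hM _ _
  | succ n ih =>
    set z : Fin (D.ar T.root) → Q := fun i => (T.subtree i).evalApprox g u n
    have hargs : dist (h.val T) (D.map T.root fun i => ι (z i)) ≤ q * (q ^ n * M + n * ε) := by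
      rw [h.val_eq_map T]
      refine ((hq _).dist_le_mul _ _).trans (mul_le_mul_of_nonneg_left ?_ q.2)
      exact (dist_pi_le_iff (by positivity)).2 fun i => ih _
    have hroot : dist (D.map T.root fun i => ι (z i)) (ι (T.evalApprox g u (n + 1))) ≤ ε := by
      simpa [InfTree.evalApprox, z] using hg T.root (List.ofFn z)
    have hqε : (q : ℝ) * (n * ε) ≤ n * ε :=
      mul_le_of_le_one_left (by positivity) (by exact_mod_cast hq1)
    calc dist (h.val T) (ι (T.evalApprox g u (n + 1)))
        ≤ q * (q ^ n * M + n * ε) + ε := (dist_triangle _ _ _).trans (add_le_add hargs hroot)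
      _ ≤ q ^ (n + 1) * M + (n + 1 : ℕ) * ε := by
        push_cast
        rw [pow_succ']
        linarith

theorem exists_computable_height {q : ℝ} (hq0 : 0 ≤ q) (hq1 : q < 1) (M : ℝ) :
    ∃ J : ℕ → ℕ, Computable J ∧
      ∀ n, q ^ J n * M + J n * (1 / 2 : ℝ) ^ (J n + n + 1) < (1 / 2) ^ n := by
  obtain ⟨e, he⟩ := pow_unbounded_of_one_lt M (one_lt_two (α := ℝ))
  obtain ⟨c, hc⟩ := exists_pow_lt_of_lt_one (show (0 : ℝ) < 1 / 2 by norm_num) hq1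
  refine ⟨fun n => c * (n + 1 + e), (Primrec.nat_mul.comp (Primrec.const c)
    (Primrec.nat_add.comp Primrec.succ (Primrec.const e))).to_comp, fun n => ?_⟩
  set J : ℕ := c * (n + 1 + e) with hJ
  have hcut : q ^ J * M ≤ (1 / 2) ^ (n + 1) :=
    calc q ^ J * M ≤ q ^ J * 2 ^ e := by gcongr
      _ ≤ (1 / 2) ^ (n + 1 + e) * 2 ^ e := by rw [hJ, pow_mul]; gcongr
      _ = (1 / 2) ^ (n + 1) := by rw [pow_add, mul_assoc, ← mul_pow]; norm_num
  have hround : (J : ℝ) * (1 / 2) ^ (J + n + 1) < (1 / 2) ^ (n + 1) :=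
    calc (J : ℝ) * (1 / 2) ^ (J + n + 1) < 2 ^ J * (1 / 2) ^ (J + n + 1) := by
          gcongr
          exact_mod_cast Nat.lt_two_pow_self
      _ = (1 / 2) ^ (n + 1) := by rw [add_assoc, pow_add, ← mul_assoc, ← mul_pow]; norm_num
  calc q ^ J * M + J * (1 / 2) ^ (J + n + 1) < (1 / 2 : ℝ) ^ (n + 1) + (1 / 2) ^ (n + 1) :=
        add_lt_add_of_le_of_lt hcut hround
    _ = (1 / 2) ^ n := by rw [pow_succ]; ring

variable {Q : Type v} [Primcodable Q] {ι : Q → X}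

theorem exists_computable_eval
    (hmap : ∀ d, ∃ g : (Fin (D.ar d) → Q) × ℕ → Q, Computable g ∧
      ∀ a n, dist (D.map d fun i => ι (a i)) (ι (g (a, n))) < (1 / 2 : ℝ) ^ n) (u : Q) :
    ∃ g : (Fin m × List Q) × ℕ → Q, Computable g ∧ ∀ d l n,
      dist (D.map d fun i => ι (l.getD i u)) (ι (g ((d, l), n))) < (1 / 2 : ℝ) ^ n := by
  choose g hg hdist using hmap
  have hargs (d : Fin m) : Computable fun (l : List Q) (i : Fin (D.ar d)) => l.getD i u :=
    (Primrec.fin_curry.2 ((Primrec.list_getD u).comp Primrec.fst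
      (Primrec.fin_val.comp Primrec.snd)).to₂).to_comp
  refine ⟨fun p => g p.1.1 (fun i => p.1.2.getD i u, p.2), ?_, fun d l n => hdist d _ n⟩
  exact (computable_uncurry_fin fun d => (hg d).comp
    (((hargs d).comp Computable.fst).pair Computable.snd)).comp
      ((Computable.fst.comp Computable.fst).pair
        ((Computable.snd.comp Computable.fst).pair Computable.snd))

theorem IsDigitSpace.exists_computable_treeToName (h : D.IsDigitSpace) [Nonempty Q]
    (hmap : ∀ d, ∃ g : (Fin (D.ar d) → Q) × ℕ → Q, Computable g ∧
      ∀ a n, dist (D.map d fun i => ι (a i)) (ι (g (a, n))) < (1 / 2 : ℝ) ^ n) :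
    ∃ F : InfTree D.ar → ℕ → Q,
      IsComputableOperator InfTree.stream id (F : InfTree D.ar →. (ℕ → Q)) ∧
      ∀ T, IsCauchyName ι (F T) (h.val T) := by
  obtain ⟨u⟩ := ‹Nonempty Q›
  obtain ⟨g, hg, hdist⟩ := exists_computable_eval hmap u
  obtain ⟨q, hq1, hq⟩ := h.exists_factor
  have := h.compact
  obtain ⟨M, hM⟩ := Metric.isBounded_iff.1 (isCompact_univ (X := X)).isBounded
  obtain ⟨J, hJ, hlt⟩ := exists_computable_height q.2 (by exact_mod_cast hq1) M
  let precision (n : ℕ) : ℕ := J n + n + 1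
  have hprecision : Computable precision :=
    Computable.succ.comp (Primrec.nat_add.to_comp.comp hJ Computable.id)
  let F (T : InfTree D.ar) (n : ℕ) : Q :=
    T.evalApprox (fun d l => g ((d, l), precision n)) u (J n)
  refine ⟨F, ?_, fun T n => ?_⟩
  · refine isComputableOperator_of_prefix (N := fun n => J n + 1) (φ := fun p =>
      (((p.1[J p.2]?.getD []).foldr (InfTree.evalStep D.ar
        (fun d l => g ((d, l), precision p.2)) u (J p.2)) []).head?.getD u)) ?_
      (Computable.succ.comp hJ) fun T n => ?_
    · refine Computable.option_getD (Primrec.list_head?.to_comp.comp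
        ((InfTree.computable_foldr_evalStep D.ar hg u).comp (Computable.pair ?_
        ((hJ.comp Computable.snd).pair (hprecision.comp Computable.snd))))) (Computable.const u)
      exact Computable.option_getD (Computable.list_getElem?.comp Computable.fst
        (hJ.comp Computable.snd)) (Computable.const [])
    · simp [InfTree.foldr_evalStep_stream, F]
  · exact (h.dist_val_evalApprox_le hq1.le hq (fun x y => hM (Set.mem_univ x) (Set.mem_univ y))
      (fun d l => (hdist d l (precision n)).le) (J n) T).trans_lt (hlt n)

end DigitSystem

/-! ### From names to trees -/

section Precision

theorem two_mul_half_pow_lt_posRat (c : ℕ × ℕ) {k : ℕ} (hk : c.2 + 2 ≤ k) :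
    2 * (1 / 2 : ℝ) ^ k < (posRat c : ℝ) :=
  calc 2 * (1 / 2 : ℝ) ^ k ≤ 2 * (1 / 2) ^ (c.2 + 2) := by
        gcongr ?_ * ?_
        exact pow_le_pow_of_le_one (by norm_num) (by norm_num) hk
    _ = 1 / 2 ^ (c.2 + 1) := by
        rw [one_div_pow, pow_succ 2 (c.2 + 1)]
        field_simp
    _ < 1 / (c.2 + 1) := by
        gcongr
        exact_mod_cast Nat.lt_two_pow_self
    _ ≤ (posRat c : ℝ) := by
        simp only [posRat]
        push_cast
        gcongr
        exact le_add_of_nonneg_left c.1.cast_nonneg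

/-- A code of a positive rational number that approximates `2^{-(n+1)}` from below. -/
def precisionCode (n : ℕ) : ℕ × ℕ := (0, 2 ^ (n + 1))

theorem computable_precisionCode : Computable precisionCode :=
  (Computable.const 0).pair <|
    (Primrec₂.unpaired'.1 Nat.Primrec.pow).to_comp.comp (Computable.const 2) Computable.succ

theorem two_mul_posRat_precisionCode_lt (n : ℕ) :
    2 * (posRat (precisionCode n) : ℝ) < (1 / 2 : ℝ) ^ n := by
  simp only [posRat, precisionCode]
  push_cast
  rw [one_div_pow, mul_div_assoc', div_lt_div_iff₀ (by positivity) (by positivity), pow_succ]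
  linarith

theorem antitone_posRat_precisionCode :
    Antitone fun n => (posRat (precisionCode n) : ℝ) := by
  intro j k hjk
  simp only [posRat, precisionCode]
  push_cast
  gcongr
  norm_num

end Precision

theorem exists_eq_of_tendsto_approx_preimage {Y X : Type*} [PseudoMetricSpace Y] [CompleteSpace Y]
    [TopologicalSpace X] [T2Space X] {f : Y → X} (hf : Continuous f) {ε : ℕ → ℝ}
    (hε : Filter.Tendsto ε Filter.atTop (nhds 0)) {b z : ℕ → Y} {x : X}
    (hb : ∀ j k, j ≤ k → dist (b j) (b k) ≤ ε j) (hz : ∀ n, dist (b n) (z n) ≤ ε n)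
    (hx : Filter.Tendsto (fun n => f (z n)) Filter.atTop (nhds x)) :
    ∃ y, f y = x ∧ ∀ n, dist (b n) y ≤ ε n := by
  obtain ⟨y, hby⟩ := cauchySeq_tendsto_of_complete (cauchySeq_of_le_tendsto_0' ε hb hε)
  have hzy : Filter.Tendsto z Filter.atTop (nhds y) :=
    hby.congr_dist (squeeze_zero (fun _ => dist_nonneg) hz hε)
  refine ⟨y, tendsto_nhds_unique ((hf.tendsto y).comp hzy) hx, fun n => ?_⟩
  exact le_of_tendsto (tendsto_const_nhds.dist hby) (Filter.eventually_atTop.2 ⟨n, hb n⟩)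

section ApproximateChoice

variable {X : Type u} [MetricSpace X] {Q : Type v} {ι : Q → X}

/-- `v` chooses, from the codes in `A`, approximate preimages under `f` of the basic elements with
these codes, as in `DigitSystem.HasApproximableChoice`; but `v` is total, with arbitrary values
outside `A`. -/
structure IsApproximateChoice (ι : Q → X) {k : ℕ} (f : (Fin k → X) → X) (A : Set Q)
    (v : (ℕ × ℕ) × Q → Fin k → Q) (μ : ℕ × ℕ → ℕ × ℕ) : Prop where
  dist_lt_max : ∀ θ θ₁, ∀ a ∈ A, dist (fun i => ι (v (θ, a) i)) (fun i => ι (v (θ₁, a) i)) <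
    max (posRat θ : ℝ) (posRat θ₁ : ℝ)
  dist_lt : ∀ θ, ∀ a ∈ A, ∀ a' ∈ A, dist (ι a) (ι a') < (posRat (μ θ) : ℝ) →
    dist (fun i => ι (v (θ, a) i)) (fun i => ι (v (θ, a') i)) < (posRat θ : ℝ)
  exists_preimage : ∀ θ, ∀ a ∈ A, ∃ y, f y = ι a ∧
    dist y (fun i => ι (v (θ, a) i)) < (posRat θ : ℝ)

theorem IsApproximateChoice.exists_isCauchyName [CompleteSpace X] {k : ℕ} {f : (Fin k → X) → X}
    {A : Set Q} {v : (ℕ × ℕ) × Q → Fin k → Q} {μ : ℕ × ℕ → ℕ × ℕ}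
    (hv : IsApproximateChoice ι f A v μ) (hf : Continuous f) {K : ℕ → ℕ} (hK : StrictMono K)
    (hμ : ∀ n, (μ (precisionCode n)).2 + 2 ≤ K n) {w : ℕ → Q} {x : X} (hw : IsCauchyName ι w x)
    (hA : ∀ n, w (K n) ∈ A) :
    ∃ y, f y = x ∧ ∀ i, IsCauchyName ι (fun n => v (precisionCode n, w (K n)) i) (y i) := by
  let ε (n : ℕ) : ℝ := 2 * (posRat (precisionCode n) : ℝ)
  let b (n : ℕ) : Fin k → X := fun i => ι (v (precisionCode n, w (K n)) i)
  have hε : Filter.Tendsto ε Filter.atTop (nhds 0) :=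
    squeeze_zero (fun n => mul_nonneg zero_le_two (by simp only [posRat]; positivity))
      (fun n => (two_mul_posRat_precisionCode_lt n).le)
      (tendsto_pow_atTop_nhds_zero_of_lt_one (r := (1 / 2 : ℝ)) (by norm_num) (by norm_num))
  have hb (j l : ℕ) (hjl : j ≤ l) : dist (b j) (b l) ≤ ε j := by
    have hinput : dist (ι (w (K j))) (ι (w (K l))) < (posRat (μ (precisionCode j)) : ℝ) :=
      (hw.dist_lt (hK.monotone hjl)).trans (two_mul_half_pow_lt_posRat _ (hμ j))
    have hprecision := hv.dist_lt_max (precisionCode j) (precisionCode l) _ (hA l)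
    rw [max_eq_left (antitone_posRat_precisionCode hjl)] at hprecision
    calc dist (b j) (b l) ≤ _ := dist_triangle _ _ _
      _ ≤ posRat (precisionCode j) + posRat (precisionCode j) :=
        add_le_add (hv.dist_lt _ _ (hA j) _ (hA l) hinput).le hprecision.le
      _ = ε j := (two_mul _).symm
  choose z hz hzb using fun n => hv.exists_preimage (precisionCode n) _ (hA n)
  obtain ⟨y, hy, hby⟩ := exists_eq_of_tendsto_approx_preimage hf hε hb (z := z) (x := x)
    (fun n => by
      rw [dist_comm]
      exact (hzb n).le.trans (by linarith [dist_nonneg.trans_lt (hzb n)]))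
    ((hw.tendsto.comp hK.tendsto_atTop).congr fun n => (hz n).symm)
  refine ⟨y, hy, fun i n => ?_⟩
  rw [dist_comm]
  exact ((dist_le_pi_dist (b n) y i).trans (hby n)).trans_lt (two_mul_posRat_precisionCode_lt n)

end ApproximateChoice

theorem IsCauchyName.ball_subset_ball {X : Type u} [MetricSpace X] {Q : Type v} {ι : Q → X}
    {w : ℕ → Q} {x : X} (hw : IsCauchyName ι w x) {b k : ℕ} (hk : b + 2 ≤ k) :
    Metric.ball (ι (w k)) (posRat (0, b) : ℝ) ⊆
      Metric.ball (ι (w (b + 2))) (posRat (1, b) : ℝ) := by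
  refine Metric.ball_subset_ball' ?_
  have hdist : dist (ι (w k)) (ι (w (b + 2))) < (posRat (0, b) : ℝ) := by
    rw [dist_comm]
    exact (hw.dist_lt hk).trans (two_mul_half_pow_lt_posRat (0, b) le_rfl)
  have htwice : (posRat (1, b) : ℝ) = posRat (0, b) + posRat (0, b) := by
    simp only [posRat]
    push_cast
    ring
  linarith

namespace DigitSystem

variable {X : Type u} {m : ℕ} [MetricSpace X] {D : DigitSystem X m} {Q : Type v} [Primcodable Q]
  {ι : Q → X}

theorem HasApproximableChoice.exists_isApproximateChoice [Nonempty Q]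
    (hch : D.HasApproximableChoice ι) (hdec : D.IsDecidable ι) (r : ℕ × ℕ) (d : Fin m) :
    ∃ v μ, Computable v ∧ Computable μ ∧ IsApproximateChoice ι (D.map d)
      {a | Metric.ball (ι a) (posRat r : ℝ) ⊆ Set.range (D.map d)} v μ := by
  obtain ⟨v, hv, hdom, hmax, ⟨μ, hμ, hcont⟩, hpre⟩ := hch d
  have hint {a : Q} (ha : Metric.ball (ι a) (posRat r : ℝ) ⊆ Set.range (D.map d)) :
      ι a ∈ interior (Set.range (D.map d)) := by
    refine interior_maximal ha Metric.isOpen_ball (Metric.mem_ball_self ?_)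
    simp only [posRat]
    positivity
  have hsafe : ComputablePred fun p : (ℕ × ℕ) × Q =>
      Metric.ball (ι p.2) (posRat r : ℝ) ⊆ Set.range (D.map d) :=
    ComputablePred.computable_of_manyOneReducible
      ⟨fun p => (p.2, r), Computable.snd.pair (Computable.const r), fun _ => Iff.rfl⟩ (hdec d)
  obtain ⟨g, hg, hgv⟩ := exists_computable_mem_of_partrec hv hsafe
    fun p hp => hdom p.1 p.2 (hint hp)
  exact ⟨g, μ, hg, hμ,
    { dist_lt_max := fun θ θ₁ a ha => hmax θ θ₁ a (hint ha) _ (hgv (θ, a) ha) _ (hgv (θ₁, a) ha)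
      dist_lt := fun θ a ha a' ha' hlt =>
        hcont θ a a' (hint ha) (hint ha') hlt _ (hgv (θ, a) ha) _ (hgv (θ, a') ha')
      exists_preimage := fun θ a ha => hpre θ a (hint ha) _ (hgv (θ, a) ha) }⟩

theorem WellCovering.exists_computable_digit [CompactSpace X] (hcov : D.WellCovering)
    (hdec : D.IsDecidable ι) :
    ∃ (b : ℕ) (digit : Q → Fin m), Computable digit ∧
      ∀ a, Metric.ball (ι a) (posRat (1, b) : ℝ) ⊆ Set.range (D.map (digit a)) := by
  obtain ⟨δ, hδ, hball⟩ := lebesgue_number_lemma_of_metric (isCompact_univ (X := X))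
    (fun d => isOpen_interior (s := Set.range (D.map d)))
    (fun x _ => Set.mem_iUnion.2 (hcov x))
  obtain ⟨b, hb⟩ := exists_nat_one_div_lt (half_pos hδ)
  have hradius : (posRat (1, b) : ℝ) ≤ δ := by
    have : (posRat (1, b) : ℝ) = 2 * (1 / (b + 1)) := by
      simp only [posRat]
      push_cast
      ring
    linarith
  have hsafe : ComputablePred fun p : Fin m × Q =>
      Metric.ball (ι p.2) (posRat (1, b) : ℝ) ⊆ Set.range (D.map p.1) := by
    choose t ht hdec using fun d => ComputablePred.computable_iff.1 (hdec d)
    exact ComputablePred.computable_iff.2 ⟨fun p => t p.1 (p.2, (1, b)),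
      computable_uncurry_fin fun d => (ht d).comp (Computable.id.pair (Computable.const (1, b))),
      funext fun p => congrFun (hdec p.1) (p.2, (1, b))⟩
  obtain ⟨digit, hdigit, hdigit_ball⟩ := exists_computable_choice hsafe fun a => by
    obtain ⟨d, hd⟩ := hball (ι a) (Set.mem_univ _)
    exact ⟨d, (Metric.ball_subset_ball hradius).trans (hd.trans interior_subset)⟩
  exact ⟨b, digit, hdigit, hdigit_ball⟩

theorem IsDigitSpace.exists_computable_preimage (h : D.IsDigitSpace) [Nonempty Q]
    (hcov : D.WellCovering) (hdec : D.IsDecidable ι) (hch : D.HasApproximableChoice ι) :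
    ∃ (k₀ : ℕ) (digit : Q → Fin m) (K : ℕ → ℕ) (component : (Q × ℕ) × ℕ × Q → Q),
      Computable digit ∧ Computable K ∧ StrictMono K ∧ Computable component ∧
      ∀ w x, IsCauchyName ι w x → ∃ y : Fin (D.ar (digit (w k₀))) → X,
        D.map (digit (w k₀)) y = x ∧ ∀ i : Fin (D.ar (digit (w k₀))),
          IsCauchyName ι (fun n => component ((w k₀, i), n, w (K n))) (y i) := by
  obtain ⟨u⟩ := ‹Nonempty Q›
  have := h.compact
  obtain ⟨b, digit, hdigit, hball⟩ := hcov.exists_computable_digit hdec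
  choose v μ hv hμ hchoice using hch.exists_isApproximateChoice hdec (0, b)
  obtain ⟨K, hK, hKmono, hKle⟩ := exists_computable_strictMono_ge_family
    (κ := fun d n => (μ d (precisionCode n)).2 + 2 + (b + 2)) fun d =>
      Primrec.nat_add.to_comp.comp (Primrec.nat_add.to_comp.comp
        (Computable.snd.comp ((hμ d).comp computable_precisionCode)) (Computable.const 2))
        (Computable.const (b + 2))
  refine ⟨b + 2, digit, K, fun p => (List.ofFn (v (digit p.1.1) (precisionCode p.2.1, p.2.2)))[
    p.1.2]?.getD u, hdigit, hK, hKmono, ?_, fun w x hw => ?_⟩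
  · have hcomponent (d : Fin m) : Computable fun p : ℕ × ℕ × Q =>
        (List.ofFn (v d (precisionCode p.2.1, p.2.2)))[p.1]?.getD u :=
      Computable.option_getD (Computable.list_getElem?.comp (Computable.list_ofFn fun i =>
        (Computable.fin_app.comp (hv d) (Computable.const i)).comp
          ((computable_precisionCode.comp (Computable.fst.comp Computable.snd)).pair
            (Computable.snd.comp Computable.snd))) Computable.fst) (Computable.const u)
    exact (computable_uncurry_fin hcomponent).comp ((hdigit.comp (Computable.fst.comp
      Computable.fst)).pair ((Computable.snd.comp Computable.fst).pair Computable.snd))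
  · obtain ⟨q, -, hq⟩ := h.contracting (digit (w (b + 2)))
    obtain ⟨y, hy, hname⟩ := (hchoice (digit (w (b + 2)))).exists_isCauchyName hq.continuous hKmono
      (fun n => (Nat.le_add_right _ _).trans (hKle _ n)) hw fun n =>
        (hw.ball_subset_ball ((Nat.le_add_left _ _).trans (hKle (digit (w (b + 2))) n))).trans
          (hball _)
    exact ⟨y, hy, fun i => by simpa using hname i⟩

theorem IsDigitSpace.exists_computable_nameToTree (h : D.IsDigitSpace) [Nonempty Q]
    (hcov : D.WellCovering) (hdec : D.IsDecidable ι) (hch : D.HasApproximableChoice ι) :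
    ∃ G : (ℕ → Q) → InfTree D.ar,
      IsComputableOperator id InfTree.stream (G : (ℕ → Q) →. InfTree D.ar) ∧
      ∀ w x, IsCauchyName ι w x → h.val (G w) = x := by
  obtain ⟨k₀, digit, K, component, hdigit, hK, hKmono, hcomponent, hpreimage⟩ :=
    h.exists_computable_preimage hcov hdec hch
  exact ⟨_, InfTree.isComputableOperator_unfold D.ar k₀ hK hKmono hdigit hcomponent,
    fun w x hw => h.val_unfold hpreimage hw⟩

end DigitSystem

theorem mainTheorem2_general {X : Type u} [MetricSpace X] {m : ℕ} (D : DigitSystem X m)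
    {Q : Type v} [Primcodable Q] [Nonempty Q] (ι : Q → X) (h : D.IsDigitSpace)
    (hmap : ∀ d, ∃ g : (Fin (D.ar d) → Q) × ℕ → Q, Computable g ∧
      ∀ a n, dist (D.map d fun i => ι (a i)) (ι (g (a, n))) < (1 / 2 : ℝ) ^ n)
    (hcov : D.WellCovering) (hdec : D.IsDecidable ι) (hch : D.HasApproximableChoice ι) :
    (∃ (F : InfTree D.ar → ℕ → Q) (G : (ℕ → Q) →. InfTree D.ar),
      IsComputableOperator InfTree.stream id (F : InfTree D.ar →. (ℕ → Q)) ∧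
      IsComputableOperator id InfTree.stream G ∧
      (∀ T : InfTree D.ar, cauchyRep ι (F T) = Part.some (h.val T)) ∧
      G.Dom = (cauchyRep ι).Dom ∧
      ∀ w : ℕ → Q, ∀ T ∈ G w, Part.some (h.val T) = cauchyRep ι w) ∧
    RepEquiv (treeRep h) (cauchyRep ι) := by
  obtain ⟨F, hF, hFname⟩ := h.exists_computable_treeToName hmap
  obtain ⟨G, hG, hGval⟩ := h.exists_computable_nameToTree hcov hdec hch
  refine ⟨⟨F, fun w => (cauchyRep ι w).map fun _ => G w, hF, hG.mono ?_, fun T => ?_, rfl, ?_⟩,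
    .of_isComputableOperator hF ?_, .of_isComputableOperator hG ?_⟩
  · rintro w T hT
    obtain ⟨-, -, rfl⟩ := (Part.mem_map_iff _).1 hT
    exact Part.mem_some _
  · exact Part.eq_some_iff.2 (mem_cauchyRep_iff.2 (hFname T))
  · rintro w T hT
    obtain ⟨x, hx, rfl⟩ := (Part.mem_map_iff _).1 hT
    rw [hGval w x (mem_cauchyRep_iff.1 hx), Part.eq_some_iff.2 hx]
  · rintro p x hx
    obtain ⟨T, hT, rfl⟩ := h.mem_treeRep_iff.1 hx
    exact ⟨T, hT, mem_cauchyRep_iff.2 (hFname T)⟩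
  · rintro w x hx
    exact ⟨w, rfl, h.mem_treeRep_iff.2 ⟨G w, rfl, hGval w x (mem_cauchyRep_iff.1 hx)⟩⟩

theorem mainTheorem2 {X : Type u} [MetricSpace X] {m : ℕ} (D : DigitSystem X m)
    {Q : Type v} [Primcodable Q] (ι : Q → X)
    (hD : D.IsComputableDigitSpace ι) (hcov : D.WellCovering)
    (hdec : D.IsDecidable ι) (hch : D.HasApproximableChoice ι) :
    (∃ (F : InfTree D.ar → ℕ → Q) (G : (ℕ → Q) →. InfTree D.ar),
      IsComputableOperator InfTree.stream id (F : InfTree D.ar →. (ℕ → Q)) ∧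
      IsComputableOperator id InfTree.stream G ∧
      (∀ T : InfTree D.ar, cauchyRep ι (F T) = Part.some (hD.isDigitSpace.val T)) ∧
      G.Dom = (cauchyRep ι).Dom ∧
      ∀ w : ℕ → Q, ∀ T ∈ G w, Part.some (hD.isDigitSpace.val T) = cauchyRep ι w) ∧
    RepEquiv (treeRep hD.isDigitSpace) (cauchyRep ι) := by
  have : Nonempty Q := hD.computableMetric.dense.nonempty_iff.2 hD.isDigitSpace.nonempty
  exact mainTheorem2_general D ι hD.isDigitSpace (fun d => (hD.computable_map d).2) hcov hdec hch
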